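/- Let $X$ be a metrizable space that is completely Baire, i.e. every closed subspace of $X$ is a Baire space, and let $Y$ be a regular topological space (points and closed sets not containing them have disjoint neighbourhoods; no further separation axiom is needed). Let $f\colon X\to Y$ be $F_\sigma$-measurable, i.e. $f^{-1}(U)$ is an $F_\sigma$ subset of $X$ for every open $U\subset Y$. Call a mapping $g\colon S\to Y$ of a topological space $S$ piecewise continuous if $S$ is the union of a sequence $S_0,S_1,\dots$ of closed subsets of $S$ such that $g\restriction S_n$ is continuous for every $n$. If the restriction $f\restriction Z$ is piecewise continuous for every closed set $Z\subset X$ that, as a subspace, is separable and zero-dimensional (i.e. its clopen subsets form a base of its topology), then $f$ is piecewise continuous. -/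

import Mathlib

open Set Topology TopologicalSpace

/-- A set is `F_σ` if it is the union of a sequence of closed sets. -/
def IsFSigma {X : Type*} [TopologicalSpace X] (s : Set X) : Prop :=
  ∃ F : ℕ → Set X, (∀ n, IsClosed (F n)) ∧ s = ⋃ n, F n

/-- A mapping is `F_σ`-measurable if the preimage of every open set is an `F_σ` set. -/
def FSigmaMeasurable {X Y : Type*} [TopologicalSpace X] [TopologicalSpace Y]
    (f : X → Y) : Prop :=
  ∀ U : Set Y, IsOpen U → IsFSigma (f ⁻¹' U)

/-- A mapping is piecewise continuous if its domain is covered by a sequence of closed sets on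
each of which the restriction of the mapping is continuous. -/
def PiecewiseContinuous {X Y : Type*} [TopologicalSpace X] [TopologicalSpace Y]
    (f : X → Y) : Prop :=
  ∃ F : ℕ → Set X, (∀ n, IsClosed (F n)) ∧ (⋃ n, F n) = univ ∧ ∀ n, ContinuousOn f (F n)

/-- A space is completely Baire if every closed subspace of it is a Baire space. -/
def CompletelyBaire (X : Type*) [TopologicalSpace X] : Prop :=
  ∀ F : Set X, IsClosed F → BaireSpace F

/-! It suffices that `f` restricted to each nonempty `A` has a continuity point: regularity upgrades
this to continuity on a nonempty relatively open part of `A`, and exhausting `X` by open sets gives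
closed pieces. If some `A` has no such point, each `q ∈ A` has a neighbourhood `W q` of `f q` missed
by values at points of `A` arbitrarily near `q`. A countable `Q ⊆ A` closed under choosing such
witnesses can be kept inside shrinking finite disjoint families of balls, so its closure is a test
set `Z`. There Baire category yields a continuity point in `Q`, which the witnesses forbid. -/

/-- A set is covered by countably many closed sets on each of which `f` is continuous. -/
def PiecewiseContinuousCover {X Y : Type*} [TopologicalSpace X] [TopologicalSpace Y]
    (f : X → Y) (s : Set X) : Prop :=
  ∃ F : ℕ → Set X, (∀ n, IsClosed (F n)) ∧ s ⊆ ⋃ n, F n ∧ ∀ n, ContinuousOn f (F n)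

namespace PiecewiseContinuousCover

variable {X Y : Type*} [TopologicalSpace X] [TopologicalSpace Y] {f : X → Y}

theorem mono {s t : Set X} (ht : PiecewiseContinuousCover f t) (h : s ⊆ t) :
    PiecewiseContinuousCover f s := by
  obtain ⟨F, hF, hc, hf⟩ := ht
  exact ⟨F, hF, h.trans hc, hf⟩

theorem of_isClosed {s : Set X} (hs : IsClosed s) (hf : ContinuousOn f s) :
    PiecewiseContinuousCover f s :=
  ⟨fun _ => s, fun _ => hs, fun _ hx => mem_iUnion.2 ⟨0, hx⟩, fun _ => hf⟩

theorem iUnion {s : ℕ → Set X} (h : ∀ n, PiecewiseContinuousCover f (s n)) :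
    PiecewiseContinuousCover f (⋃ n, s n) := by
  choose F hF hc hf using h
  refine ⟨fun k => F k.unpair.1 k.unpair.2, fun k => hF _ _, ?_, fun k => hf _ _⟩
  refine iUnion_subset fun n x hx => ?_
  obtain ⟨m, hm⟩ := mem_iUnion.1 (hc n hx)
  exact mem_iUnion.2 ⟨Nat.pair n m, by simpa using hm⟩

theorem union {s t : Set X} (hs : PiecewiseContinuousCover f s)
    (ht : PiecewiseContinuousCover f t) : PiecewiseContinuousCover f (s ∪ t) := by
  refine (iUnion (s := fun n => if n = 0 then s else t) fun n => ?_).mono ?_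
  · split_ifs
    exacts [hs, ht]
  · rintro x (hx | hx)
    · exact mem_iUnion.2 ⟨0, by simpa using hx⟩
    · exact mem_iUnion.2 ⟨1, by simpa using hx⟩

/-- A closed set covered by open sets that have a piecewise continuous cover has one as well. -/
theorem of_isClosed_of_subset_iUnion [T2Space X] [ParacompactSpace X] {ι : Type*} {s : Set X}
    (hs : IsClosed s) {u : ι → Set X} (uo : ∀ i, IsOpen (u i)) (us : s ⊆ ⋃ i, u i)
    (h : ∀ i, PiecewiseContinuousCover f (u i)) : PiecewiseContinuousCover f s := by
  obtain ⟨v, -, hsv, hv, hvu⟩ := precise_refinement_set hs u uo us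
  choose F hF hc hf using h
  -- Local finiteness merges the `n`-th pieces over all `i` into one closed set.
  have hlf : ∀ n, LocallyFinite fun i => F i n ∩ closure (v i) := fun n =>
    hv.closure.subset fun i => inter_subset_right
  have hcl : ∀ n i, IsClosed (F i n ∩ closure (v i)) := fun n i => (hF i n).inter isClosed_closure
  refine ⟨fun n => ⋃ i, F i n ∩ closure (v i), fun n => (hlf n).isClosed_iUnion (hcl n), ?_,
    fun n => (hlf n).continuousOn_iUnion (hcl n) fun i => (hf i n).mono inter_subset_left⟩
  intro x hx
  obtain ⟨i, hi⟩ := mem_iUnion.1 (hsv hx)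
  obtain ⟨n, hn⟩ := mem_iUnion.1 (hc i (hvu i hi))
  exact mem_iUnion.2 ⟨n, mem_iUnion.2 ⟨i, hn, subset_closure hi⟩⟩

/-- The union is open, hence `F_σ`, and paracompactness handles each closed piece. -/
theorem sUnion_of_isOpen [MetrizableSpace X] {𝒰 : Set (Set X)} (ho : ∀ U ∈ 𝒰, IsOpen U)
    (h : ∀ U ∈ 𝒰, PiecewiseContinuousCover f U) : PiecewiseContinuousCover f (⋃₀ 𝒰) := by
  let := metrizableSpaceMetric X
  obtain ⟨C, hC, hCU, hCe, -⟩ := (isOpen_sUnion ho).exists_iUnion_isClosed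
  rw [← hCe]
  refine iUnion fun n => of_isClosed_of_subset_iUnion (hC n) (u := fun U : 𝒰 => (U : Set X))
    (fun U => ho U U.2) ?_ fun U => h U U.2
  rw [← sUnion_eq_iUnion]
  exact hCU n

theorem piecewiseContinuous (h : PiecewiseContinuousCover f univ) : PiecewiseContinuous f := by
  obtain ⟨F, hF, hc, hf⟩ := h
  exact ⟨F, hF, univ_subset_iff.1 hc, hf⟩

end PiecewiseContinuousCover

/-- A map that is continuous on a nonempty relatively open part of every nonempty set is
piecewise continuous. -/
theorem piecewiseContinuous_of_forall_exists_isOpen {X Y : Type*} [TopologicalSpace X]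
    [MetrizableSpace X] [TopologicalSpace Y] {f : X → Y}
    (h : ∀ A : Set X, A.Nonempty → ∃ U, IsOpen U ∧ (A ∩ U).Nonempty ∧ ContinuousOn f (A ∩ U)) :
    PiecewiseContinuous f := by
  let := metrizableSpaceMetric X
  set 𝒰 : Set (Set X) := {U | IsOpen U ∧ PiecewiseContinuousCover f U} with h𝒰
  have hG : PiecewiseContinuousCover f (⋃₀ 𝒰) :=
    .sUnion_of_isOpen (fun U hU => hU.1) fun U hU => hU.2
  have hGo : IsOpen (⋃₀ 𝒰) := isOpen_sUnion fun U hU => hU.1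
  suffices H : ⋃₀ 𝒰 = univ from (H ▸ hG).piecewiseContinuous
  by_contra hne
  obtain ⟨U, hU, ⟨x, hxA, hxU⟩, hfU⟩ := h (⋃₀ 𝒰)ᶜ (nonempty_compl.2 hne)
  obtain ⟨C, hC, -, hCe, -⟩ := hU.exists_iUnion_isClosed
  have hAU : PiecewiseContinuousCover f (⋃ n, (⋃₀ 𝒰)ᶜ ∩ C n) :=
    .iUnion fun n => .of_isClosed (hGo.isClosed_compl.inter (hC n))
      (hfU.mono (inter_subset_inter_right _ (hCe ▸ subset_iUnion C n)))
  refine hxA (mem_sUnion_of_mem hxU ⟨hU, (hAU.union hG).mono fun y hy => ?_⟩)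
  by_cases hyG : y ∈ ⋃₀ 𝒰
  · exact Or.inr hyG
  · rw [← inter_iUnion, hCe]
    exact Or.inl ⟨hyG, hy⟩

/-- If `f` restricted to every nonempty set has a point of continuity, then every nonempty set
has a nonempty relatively open part on which `f` is continuous. -/
theorem exists_isOpen_continuousOn_of_forall_exists_continuousWithinAt {X Y : Type*}
    [TopologicalSpace X] [TopologicalSpace Y] [RegularSpace Y] {f : X → Y}
    (h : ∀ A : Set X, A.Nonempty → ∃ a ∈ A, ContinuousWithinAt f A a)
    {A : Set X} (hA : A.Nonempty) :
    ∃ U, IsOpen U ∧ (A ∩ U).Nonempty ∧ ContinuousOn f (A ∩ U) := by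
  set D : Set X := {a ∈ A | ¬ContinuousWithinAt f A a} with hD
  by_cases hdense : A ⊆ closure D
  · exfalso
    have hDne : D.Nonempty := closure_nonempty_iff.1 (hA.mono hdense)
    obtain ⟨d, hd, hfd⟩ := h D hDne
    refine hd.2 ?_
    rw [ContinuousWithinAt, (closed_nhds_basis (f d)).tendsto_right_iff]
    rintro W ⟨hW, hWc⟩
    obtain ⟨V, hV, hdV, hVW⟩ := mem_nhdsWithin.1 (hfd hW)
    -- If `f a ∉ W`, then `a ∉ D`, so `f` avoids the closed set `W` on `A` near `a`; but points of
    -- `D` near `a` have values in `W`.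
    filter_upwards [self_mem_nhdsWithin, mem_nhdsWithin_of_mem_nhds (hV.mem_nhds hdV)] with a haA haV
    by_contra haW
    have hca : ContinuousWithinAt f A a := by
      by_contra hca
      exact haW (hVW ⟨haV, haA, hca⟩)
    obtain ⟨O, hO, haO, hOW⟩ := mem_nhdsWithin.1 (hca (hWc.isOpen_compl.mem_nhds haW))
    obtain ⟨e, ⟨heO, heV⟩, heD⟩ := mem_closure_iff.1 (hdense haA) _ (hO.inter hV) ⟨haO, haV⟩
    exact hOW ⟨heO, heD.1⟩ (hVW ⟨heV, heD⟩)
  · obtain ⟨a, haA, ha⟩ := not_subset.1 hdense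
    refine ⟨(closure D)ᶜ, isClosed_closure.isOpen_compl, ⟨a, haA, ha⟩, fun x hx => ?_⟩
    by_contra hc
    exact hx.2 (subset_closure ⟨hx.1, fun hc' => hc (hc'.mono inter_subset_left)⟩)

/-- The closure of a set that is covered by finite disjoint families of arbitrarily small closed
balls is zero-dimensional. -/
theorem hasSmallInductiveDimensionLE_zero_closure {X : Type*} [MetricSpace X] {Q : Set X}
    (h : ∀ ε > 0, ∃ T : Set X, T.Finite ∧ ∃ ρ < ε, Q ⊆ ⋃ q ∈ T, Metric.closedBall q ρ ∧
      T.PairwiseDisjoint fun q => Metric.closedBall q ρ) :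
    HasSmallInductiveDimensionLE (closure Q) 0 := by
  refine hasSmallInductiveDimensionLT_one_iff.2
    (isTopologicalBasis_of_isOpen_of_nhds (fun U hU => hU.isOpen) fun z U hz hU => ?_)
  obtain ⟨ε, hε, hεU⟩ := Metric.isOpen_iff.1 hU z hz
  obtain ⟨T, hT, ρ, hρ, hQ, hdisj⟩ := h (ε / 2) (by positivity)
  have hcl : ∀ T' ⊆ T, IsClosed (⋃ q ∈ T', Metric.closedBall q ρ) := fun T' hT' =>
    (hT.subset hT').isClosed_biUnion fun q _ => Metric.isClosed_closedBall
  have hZ : closure Q ⊆ ⋃ q ∈ T, Metric.closedBall q ρ := closure_minimal hQ (hcl T subset_rfl)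
  obtain ⟨q, hq, hzq⟩ := mem_iUnion₂.1 (hZ z.2)
  refine ⟨((↑) : closure Q → X) ⁻¹' Metric.closedBall q ρ,
    ⟨Metric.isClosed_closedBall.preimage continuous_subtype_val, ?_⟩, hzq, fun y hy => hεU ?_⟩
  · have : ((↑) : closure Q → X) ⁻¹' Metric.closedBall q ρ =
        (↑) ⁻¹' (⋃ p ∈ T \ {q}, Metric.closedBall p ρ)ᶜ := by
      ext y
      constructor
      · intro hy hy'
        obtain ⟨p, hp, hyp⟩ := mem_iUnion₂.1 hy'
        exact disjoint_left.1 (hdisj hp.1 hq hp.2) hyp hy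
      · intro hy
        obtain ⟨p, hp, hyp⟩ := mem_iUnion₂.1 (hZ y.2)
        by_cases hpq : p = q
        · exact hpq ▸ hyp
        · exact (hy (mem_iUnion₂.2 ⟨p, ⟨hp, hpq⟩, hyp⟩)).elim
    rw [this]
    exact (hcl _ sdiff_subset).isOpen_compl.preimage continuous_subtype_val
  · have h1 : dist (y : X) q ≤ ρ := hy
    have h2 : dist (z : X) q ≤ ρ := hzq
    have h3 := dist_triangle_right (y : X) z q
    rw [Metric.mem_ball, Subtype.dist_eq]
    linarith

/-- Finitely many points of an open set have disjoint small closed balls inside that set. -/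
theorem exists_pairwiseDisjoint_closedBall {X : Type*} [MetricSpace X] {S O : Set X}
    (hS : S.Finite) (hO : IsOpen O) (hSO : S ⊆ O) {ε : ℝ} (hε : 0 < ε) :
    ∃ ρ > 0, ρ < ε ∧ (∀ q ∈ S, Metric.closedBall q ρ ⊆ O) ∧
      S.PairwiseDisjoint fun q => Metric.closedBall q ρ := by
  have h1 : ∀ᶠ ρ : ℝ in 𝓝[>] 0, ∀ q ∈ S, Metric.closedBall q ρ ⊆ O := by
    refine (Filter.eventually_all_finite hS).2 fun q hq => ?_
    obtain ⟨δ, hδ, hδO⟩ := Metric.isOpen_iff.1 hO q (hSO hq)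
    filter_upwards [Ioo_mem_nhdsGT hδ] with ρ hρ
    exact (Metric.closedBall_subset_ball hρ.2).trans hδO
  have h2 : ∀ᶠ ρ : ℝ in 𝓝[>] 0, ∀ q ∈ S, ∀ p ∈ S, q ≠ p →
      Disjoint (Metric.closedBall q ρ) (Metric.closedBall p ρ) := by
    refine (Filter.eventually_all_finite hS).2 fun q _ =>
      (Filter.eventually_all_finite hS).2 fun p _ => ?_
    by_cases hqp : q = p
    · exact .of_forall fun _ h => (h hqp).elim
    · filter_upwards [Ioo_mem_nhdsGT (half_pos (dist_pos.2 hqp))] with ρ hρ _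
      exact Metric.closedBall_disjoint_closedBall (by linarith [hρ.2])
  have h3 : ∀ᶠ ρ : ℝ in 𝓝[>] 0, ρ ∈ Ioo 0 ε := Ioo_mem_nhdsGT hε
  obtain ⟨ρ, ⟨hρ1, hρ2⟩, hρ⟩ := (h3.and (h1.and h2)).exists
  exact ⟨ρ, hρ1, hρ2, hρ.1, fun q hq p hp => hρ.2 q hq p hp⟩

/-- If every point `q` of a nonempty set `A` is a limit of points `x` of `A` with `R q x`, then
`A` has a nonempty countable subset with the same property and zero-dimensional closure. -/
theorem exists_countable_subset_zeroDimensional_closure {X : Type*} [MetricSpace X] {A : Set X}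
    (hA : A.Nonempty) (R : X → X → Prop)
    (hR : ∀ q ∈ A, ∀ ε > 0, ∃ x ∈ A, dist x q < ε ∧ R q x) :
    ∃ Q : Set X, Q.Countable ∧ Q.Nonempty ∧
      (∀ q ∈ Q, ∀ ε > 0, ∃ x ∈ Q, dist x q < ε ∧ R q x) ∧
      HasSmallInductiveDimensionLE (closure Q) 0 := by
  -- Pairs of the points chosen so far and an open set confining all later ones.
  let State := {p : Set X × Set X // p.1.Finite ∧ p.1 ⊆ A ∧ IsOpen p.2 ∧ p.1 ⊆ p.2}
  have step : ∀ (s : State) (ε : ℝ), 0 < ε → ∃ t : State, s.1.1 ⊆ t.1.1 ∧ t.1.2 ⊆ s.1.2 ∧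
      (∀ q ∈ s.1.1, ∃ x ∈ t.1.1, dist x q < ε ∧ R q x) ∧
      ∃ ρ < ε, t.1.2 ⊆ ⋃ q ∈ t.1.1, Metric.closedBall q ρ ∧
        t.1.1.PairwiseDisjoint fun q => Metric.closedBall q ρ := by
    rintro ⟨⟨S, O⟩, hS, hSA, hO, hSO⟩ ε hε
    dsimp only at hS hSA hO hSO ⊢
    have hex : ∀ q ∈ S, ∃ x, x ∈ A ∧ x ∈ O ∧ dist x q < ε ∧ R q x := by
      intro q hq
      obtain ⟨δ, hδ, hδO⟩ := Metric.isOpen_iff.1 hO q (hSO hq)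
      obtain ⟨x, hxA, hxq, hxR⟩ := hR q (hSA hq) (min ε δ) (lt_min hε hδ)
      exact ⟨x, hxA, hδO (hxq.trans_le (min_le_right _ _)), hxq.trans_le (min_le_left _ _), hxR⟩
    choose! c hcA hcO hcq hcR using hex
    have hfin : (S ∪ c '' S).Finite := hS.union (hS.image c)
    have hTA : S ∪ c '' S ⊆ A := union_subset hSA (image_subset_iff.2 hcA)
    have hTO : S ∪ c '' S ⊆ O := union_subset hSO (image_subset_iff.2 hcO)
    obtain ⟨ρ, hρ, hρε, hρO, hdisj⟩ := exists_pairwiseDisjoint_closedBall hfin hO hTO hε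
    refine ⟨⟨(S ∪ c '' S, ⋃ q ∈ S ∪ c '' S, Metric.ball q ρ), hfin, hTA,
      isOpen_biUnion fun q _ => Metric.isOpen_ball,
      fun q hq => mem_iUnion₂.2 ⟨q, hq, Metric.mem_ball_self hρ⟩⟩, subset_union_left,
      iUnion₂_subset fun q hq => Metric.ball_subset_closedBall.trans (hρO q hq),
      fun q hq => ⟨c q, Or.inr (mem_image_of_mem c hq), hcq q hq, hcR q hq⟩, ρ, hρε,
      iUnion₂_mono fun q _ => Metric.ball_subset_closedBall, hdisj⟩
  obtain ⟨a, ha⟩ := hA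
  choose! next hS hO hnext hball using step
  let s : ℕ → State := fun n => Nat.rec
    ⟨({a}, univ), finite_singleton a, singleton_subset_iff.2 ha, isOpen_univ, subset_univ _⟩
    (fun n t => next t (1 / ((n : ℝ) + 1))) n
  have hpos : ∀ n : ℕ, (0 : ℝ) < 1 / ((n : ℝ) + 1) := fun n => Nat.one_div_pos_of_nat
  have hs : ∀ n, s (n + 1) = next (s n) (1 / ((n : ℝ) + 1)) := fun n => rfl
  have hmono : Monotone fun n => (s n).1.1 :=
    monotone_nat_of_le_succ fun n => hs n ▸ hS (s n) _ (hpos n)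
  have hanti : Antitone fun n => (s n).1.2 :=
    antitone_nat_of_succ_le fun n => hs n ▸ hO (s n) _ (hpos n)
  refine ⟨⋃ n, (s n).1.1, countable_iUnion fun n => (s n).2.1.countable,
    ⟨a, mem_iUnion.2 ⟨0, rfl⟩⟩, fun q hq ε hε => ?_,
    hasSmallInductiveDimensionLE_zero_closure fun ε hε => ?_⟩
  · obtain ⟨m, hm⟩ := mem_iUnion.1 hq
    obtain ⟨k, hk⟩ := exists_nat_one_div_lt hε
    obtain ⟨x, hx, hxq, hxR⟩ :=
      hnext (s (max m k)) _ (hpos (max m k)) q (hmono (le_max_left m k) hm)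
    refine ⟨x, mem_iUnion.2 ⟨max m k + 1, hx⟩, (hxq.trans_le ?_).trans hk, hxR⟩
    exact Nat.one_div_le_one_div (le_max_right m k)
  · obtain ⟨k, hk⟩ := exists_nat_one_div_lt hε
    obtain ⟨ρ, hρ, hcov, hdisj⟩ := hball (s k) _ (hpos k)
    refine ⟨(s (k + 1)).1.1, (s (k + 1)).2.1, ρ, hρ.trans hk, iUnion_subset fun n => ?_, hdisj⟩
    calc (s n).1.1 ⊆ (s (max n (k + 1))).1.1 := hmono (le_max_left _ _)
      _ ⊆ (s (max n (k + 1))).1.2 := (s (max n (k + 1))).2.2.2.2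
      _ ⊆ (s (k + 1)).1.2 := hanti (le_max_right _ _)
      _ ⊆ _ := hcov

/-- A piecewise continuous map on a nonempty Baire space is continuous at some point of any given
dense set. -/
theorem PiecewiseContinuous.exists_continuousAt {Z Y : Type*} [TopologicalSpace Z] [BaireSpace Z]
    [Nonempty Z] [TopologicalSpace Y] {g : Z → Y} (hg : PiecewiseContinuous g) {D : Set Z}
    (hD : Dense D) : ∃ d ∈ D, ContinuousAt g d := by
  obtain ⟨F, hF, hc, hgF⟩ := hg
  obtain ⟨n, hn⟩ := nonempty_interior_of_iUnion_of_closed hF hc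
  obtain ⟨d, hdn, hdD⟩ := hD.inter_open_nonempty _ isOpen_interior hn
  exact ⟨d, hdD, (hgF n).continuousAt (mem_interior_iff_mem_nhds.1 hdn)⟩

theorem mainTheorem7 {X Y : Type*} [TopologicalSpace X] [MetrizableSpace X]
    [TopologicalSpace Y] [RegularSpace Y]
    (hX : CompletelyBaire X) (f : X → Y) (hf : FSigmaMeasurable f)
    (hZ : ∀ Z : Set X, IsClosed Z → SeparableSpace Z → HasSmallInductiveDimensionLE Z 0 →
      PiecewiseContinuous (fun z : Z => f z)) :
    PiecewiseContinuous f := by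
  let := metrizableSpaceMetric X
  refine piecewiseContinuous_of_forall_exists_isOpen fun A hA =>
    exists_isOpen_continuousOn_of_forall_exists_continuousWithinAt (fun A hA => ?_) hA
  by_contra! hdisc
  have hW : ∀ a ∈ A, ∃ W ∈ 𝓝 (f a), ∀ ε > 0, ∃ x ∈ A, dist x a < ε ∧ f x ∉ W := by
    intro a ha
    by_contra! hcon
    refine hdisc a ha fun W hW => ?_
    obtain ⟨ε, hε, h⟩ := hcon W hW
    exact Metric.mem_nhdsWithin_iff.2 ⟨ε, hε, fun x hx => h x hx.2 hx.1⟩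
  choose! W hWn hWx using hW
  obtain ⟨Q, hQc, hQne, hQ, hdim⟩ :=
    exists_countable_subset_zeroDimensional_closure (A := A) hA
      -- The neighbourhood condition is put into the relation because `Q ⊆ A` is not returned.
      (fun q x => W q ∈ 𝓝 (f q) ∧ f x ∉ W q) fun q hq ε hε => by
        obtain ⟨x, hx, hxq, hxW⟩ := hWx q hq ε hε
        exact ⟨x, hx, hxq, hWn q hq, hxW⟩
  have hsep : SeparableSpace (closure Q) := (hQc.isSeparable.closure).separableSpace
  have : BaireSpace (closure Q) := hX _ isClosed_closure
  have : Nonempty (closure Q) := hQne.closure.to_subtype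
  have hD : Dense ((↑) ⁻¹' Q : Set (closure Q)) := by
    intro z
    rw [closure_subtype, Subtype.image_preimage_coe,
      inter_eq_right.2 (subset_closure : Q ⊆ closure Q)]
    exact z.2
  obtain ⟨d, hd, hfd⟩ :=
    (hZ (closure Q) isClosed_closure hsep hdim).exists_continuousAt hD
  obtain ⟨-, -, -, hWd, -⟩ := hQ d hd 1 one_pos
  obtain ⟨ε, hε, hεW⟩ := Metric.mem_nhds_iff.1 (hfd hWd)
  obtain ⟨x, hx, hxd, -, hxW⟩ := hQ d hd ε hε
  exact hxW (hεW (show (⟨x, subset_closure hx⟩ : closure Q) ∈ Metric.ball d ε from hxd))
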